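/- For a group $Q$ write $x^y=y^{-1}xy$ and $[x,y]=x^{-1}y^{-1}xy$. Let $Q\wedge Q$ be the group generated by the symbols $x\wedge y$ ($x,y\in Q$) subject to the relations $xy\wedge z=(x^y\wedge z^y)(y\wedge z)$, $x\wedge yz=(x\wedge z)(x^z\wedge y^z)$ and $x\wedge x=1$ for all $x,y,z\in Q$. Let $\mathrm{M}(Q)$ be the kernel of the homomorphism $Q\wedge Q\to[Q,Q]$, $x\wedge y\mapsto[x,y]$, let $\mathrm{M}_0(Q)=\langle x\wedge y\mid x,y\in Q,\ [x,y]=1\rangle\le\mathrm{M}(Q)$, and let $\mathrm{B}_0(Q)=\mathrm{M}(Q)/\mathrm{M}_0(Q)$ be the Bogomolov multiplier of $Q$. A CP cover of $Q$ is a group extension $1\to N\xrightarrow{\chi}G\xrightarrow{\pi}Q\to1$ which is central ($\chi(N)\le Z(G)$), stem ($\chi(N)\le[G,G]$), and commutativity preserving (any two commuting elements of $Q$ have commuting lifts in $G$), and which satisfies $|N|=|\mathrm{B}_0(Q)|$. Theorem. Let $Q$ be a finite group and let $1\to N\to G\to Q\to1$ be a CP cover of $Q$. Then $\mathrm{B}_0(G)$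 is trivial. -/

import Mathlib

/-! ### The non-abelian exterior square and the Bogomolov multiplier

Conventions: `x ^ y = y⁻¹ x y` and `[x, y] = x⁻¹ y⁻¹ x y`. -/

namespace CPExt

/-- Right conjugation `x ^ y = y⁻¹ x y`. -/
def rconj {Q : Type*} [Group Q] (x y : Q) : Q := y⁻¹ * x * y

/-- The defining relators of the non-abelian exterior square `Q ∧ Q`; the free generator
`(x, y)` stands for the symbol `x ∧ y`. They encode
`xy ∧ z = (x ^ y ∧ z ^ y)(y ∧ z)`, `x ∧ yz = (x ∧ z)(x ^ z ∧ y ^ z)` and `x ∧ x = 1`. -/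
def exteriorRels (Q : Type*) [Group Q] : Set (FreeGroup (Q × Q)) :=
  {r | ∃ x y z : Q, r = FreeGroup.of (x * y, z) *
      (FreeGroup.of (rconj x y, rconj z y) * FreeGroup.of (y, z))⁻¹} ∪
  {r | ∃ x y z : Q, r = FreeGroup.of (x, y * z) *
      (FreeGroup.of (x, z) * FreeGroup.of (rconj x z, rconj y z))⁻¹} ∪
  {r | ∃ x : Q, r = FreeGroup.of (x, x)}

/-- The non-abelian exterior square `Q ∧ Q`. -/
abbrev ExteriorSquare (Q : Type*) [Group Q] : Type _ := PresentedGroup (exteriorRels Q)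

/-- The generator `x ∧ y` of `Q ∧ Q`. -/
def wedge {Q : Type*} [Group Q] (x y : Q) : ExteriorSquare Q :=
  PresentedGroup.of (x, y)

/-- The homomorphism `Q ∧ Q → Q`, `x ∧ y ↦ [x, y] = x⁻¹ y⁻¹ x y`. Its image is the derived
subgroup, so its kernel is that of the surjection `Q ∧ Q → [Q, Q]`. -/
def commutatorMap (Q : Type*) [Group Q] : ExteriorSquare Q →* Q :=
  PresentedGroup.toGroup (rels := exteriorRels Q)
    (f := fun p : Q × Q => p.1⁻¹ * p.2⁻¹ * p.1 * p.2) (by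
      rintro r ((⟨x, y, z, rfl⟩ | ⟨x, y, z, rfl⟩) | ⟨x, rfl⟩) <;>
        simp [rconj, mul_assoc])

/-- `M(Q)`, the kernel of `Q ∧ Q → [Q, Q]` (the Schur multiplier of `Q`). -/
def schurM (Q : Type*) [Group Q] : Subgroup (ExteriorSquare Q) := (commutatorMap Q).ker

/-- `M₀(Q)`, the subgroup of `Q ∧ Q` generated by all `x ∧ y` with `[x, y] = 1`. -/
def schurM₀ (Q : Type*) [Group Q] : Subgroup (ExteriorSquare Q) :=
  Subgroup.closure {w | ∃ x y : Q, Commute x y ∧ w = wedge x y}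

section Facts

variable {Q : Type*} [Group Q]

theorem commutatorMap_wedge (x y : Q) :
    commutatorMap Q (wedge x y) = x⁻¹ * y⁻¹ * x * y :=
  PresentedGroup.toGroup.of _

theorem wedge_mul_left (x y z : Q) :
    wedge (x * y) z = wedge (rconj x y) (rconj z y) * wedge y z := by
  have h : FreeGroup.of (x * y, z) *
      (FreeGroup.of (rconj x y, rconj z y) * FreeGroup.of (y, z))⁻¹ ∈ exteriorRels Q :=
    Or.inl (Or.inl ⟨x, y, z, rfl⟩)
  exact mul_inv_eq_one.mp (PresentedGroup.one_of_mem h)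

theorem wedge_mul_right (x y z : Q) :
    wedge x (y * z) = wedge x z * wedge (rconj x z) (rconj y z) := by
  have h : FreeGroup.of (x, y * z) *
      (FreeGroup.of (x, z) * FreeGroup.of (rconj x z, rconj y z))⁻¹ ∈ exteriorRels Q :=
    Or.inl (Or.inr ⟨x, y, z, rfl⟩)
  exact mul_inv_eq_one.mp (PresentedGroup.one_of_mem h)

theorem wedge_self (x : Q) : wedge x x = 1 :=
  PresentedGroup.one_of_mem (rels := exteriorRels Q) (x := FreeGroup.of (x, x))
    (Or.inr ⟨x, rfl⟩)

theorem rconj_rconj (x y z : Q) : rconj (rconj x y) z = rconj x (y * z) := by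
  simp [rconj, mul_assoc]

theorem rconj_mul (x y z : Q) : rconj (x * y) z = rconj x z * rconj y z := by
  simp [rconj, mul_assoc]

theorem wedge_conj_aux (x z y w : Q) :
    wedge (rconj x (w * y)) (rconj z (w * y)) * wedge y w =
      wedge y w * wedge (rconj x (y * w)) (rconj z (y * w)) := by
  have h1 := wedge_mul_left x y (z * w)
  have h2 := wedge_mul_right (x * y) z w
  rw [rconj_mul, wedge_mul_right (rconj x y), wedge_mul_right y z w, rconj_rconj, rconj_rconj] at h1
  rw [wedge_mul_left x y w, rconj_mul, wedge_mul_left (rconj x w), rconj_rconj, rconj_rconj] at h2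
  have e1 : y * rconj w y = w * y := by simp [rconj, mul_assoc]
  have e2 : w * rconj y w = y * w := by simp [rconj, mul_assoc]
  rw [e1] at h1
  rw [e2] at h2
  have h := h1.symm.trans h2
  simp only [← mul_assoc] at h
  have h' := mul_right_cancel h
  simp only [mul_assoc] at h'
  exact mul_left_cancel h'

theorem wedge_conj_wedge (a c y w : Q) :
    wedge a c * wedge y w =
      wedge y w * wedge (rconj a (commutatorMap Q (wedge y w)))
        (rconj c (commutatorMap Q (wedge y w))) := by
  have h := wedge_conj_aux (rconj a (w * y)⁻¹) (rconj c (w * y)⁻¹) y w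
  simp only [rconj_rconj] at h
  rw [commutatorMap_wedge]
  simpa [rconj, mul_assoc] using h

theorem wedge_mul_eq (t : ExteriorSquare Q) : ∀ a c : Q,
    wedge a c * t =
      t * wedge (rconj a (commutatorMap Q t)) (rconj c (commutatorMap Q t)) := by
  have ht : t ∈ Subgroup.closure
      (Set.range (PresentedGroup.of : Q × Q → PresentedGroup (exteriorRels Q))) := by
    rw [PresentedGroup.closure_range_of]; trivial
  induction ht using Subgroup.closure_induction with
  | mem x hx =>
    obtain ⟨⟨y, w⟩, rfl⟩ := hx
    exact fun a c => wedge_conj_wedge a c y w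
  | one => intro a c; simp [rconj]
  | mul s t _ _ hs ht =>
    intro a c
    rw [← mul_assoc, hs, mul_assoc, ht, ← mul_assoc, rconj_rconj, rconj_rconj, map_mul]
  | inv s _ hs =>
    intro a c
    have h := hs (rconj a (commutatorMap Q s⁻¹)) (rconj c (commutatorMap Q s⁻¹))
    rw [rconj_rconj, rconj_rconj, ← map_mul, inv_mul_cancel, map_one] at h
    rw [eq_inv_mul_iff_mul_eq, ← mul_assoc, mul_inv_eq_iff_eq_mul, h]
    simp [rconj]

/-- `M(Q)` is central in `Q ∧ Q`. -/
theorem schurM_le_center : schurM Q ≤ Subgroup.center (ExteriorSquare Q) := by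
  intro t ht
  have ht1 : commutatorMap Q t = 1 := ht
  rw [Subgroup.mem_center_iff]
  intro g
  have hg : g ∈ Subgroup.closure
      (Set.range (PresentedGroup.of : Q × Q → PresentedGroup (exteriorRels Q))) := by
    rw [PresentedGroup.closure_range_of]; trivial
  have hle : Subgroup.closure
      (Set.range (PresentedGroup.of : Q × Q → PresentedGroup (exteriorRels Q))) ≤
      Subgroup.centralizer {t} := by
    rw [Subgroup.closure_le]
    rintro _ ⟨⟨a, c⟩, rfl⟩
    have h := wedge_mul_eq t a c
    rw [ht1] at h
    simp only [rconj, inv_one, one_mul, mul_one] at h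
    exact Subgroup.mem_centralizer_singleton_iff.mpr h
  exact Subgroup.mem_centralizer_singleton_iff.mp (hle hg)

/-- `M₀(Q)` is contained in `M(Q)`. -/
theorem schurM₀_le_schurM : schurM₀ Q ≤ schurM Q := by
  rw [schurM₀, Subgroup.closure_le]
  rintro _ ⟨x, y, hxy, rfl⟩
  change commutatorMap Q (wedge x y) = 1
  rw [commutatorMap_wedge, mul_assoc, hxy.eq]
  simp [mul_assoc]

end Facts

instance schurM₀_normal (Q : Type*) [Group Q] : ((schurM₀ Q).subgroupOf (schurM Q)).Normal where
  conj_mem n hn g := by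
    have h : g * n = n * g :=
      Subtype.ext ((Subgroup.mem_center_iff.mp (schurM_le_center n.2)) g.1)
    rwa [h, mul_inv_cancel_right]

/-- The Bogomolov multiplier `B₀(Q) = M(Q) / M₀(Q)`. -/
abbrev BogomolovMultiplier (Q : Type*) [Group Q] : Type _ :=
  schurM Q ⧸ (schurM₀ Q).subgroupOf (schurM Q)

/-! ### Commutativity preserving extensions -/

section Extensions

variable {N G Q : Type*} [Group N] [Group G] [Group Q]

/-- The extension `1 → N → G → Q → 1` is commutativity preserving: commuting pairs of elements
of `Q` have commuting lifts in `G`. -/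
def IsCP (e : GroupExtension N G Q) : Prop :=
  ∀ x y : Q, Commute x y → ∃ g h : G, e.rightHom g = x ∧ e.rightHom h = y ∧ Commute g h

/-- The extension is central: the image of `N` lies in the center of `G`. -/
def IsCentral (e : GroupExtension N G Q) : Prop := e.inl.range ≤ Subgroup.center G

/-- The extension is stem: the image of `N` lies in the derived subgroup of `G`. -/
def IsStem (e : GroupExtension N G Q) : Prop := e.inl.range ≤ commutator G

/-- A CP cover of `Q`: a stem central CP extension of a group `N` by `Q` with
`|N| = |B₀(Q)|` (equality of cardinalities). -/
structure IsCPCover (e : GroupExtension N G Q) : Prop where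
  central : IsCentral e
  stem : IsStem e
  cp : IsCP e
  card_eq : Nonempty (N ≃ BogomolovMultiplier Q)

end Extensions

end CPExt

namespace CPExt

/-! Modulo `M₀(G)`, the class of `g ∧ h` depends only on the images of `g` and `h` in `Q`, because
`N` is central. This gives a surjection `Q ∧ Q → (G ∧ G)/M₀(G)` (`curlyLift`), which kills `M₀(Q)`
because commuting pairs lift to commuting pairs. Following it with the commutator map gives `Q ∧ Q →
G`, inducing a map from `B₀(Q)` onto `N` by the stem condition. Since `|N| = |B₀(Q)|` is finite,
that map is injective, so the kernel of `Q ∧ Q → G` lies in `M₀(Q)`. An element of `M(G)` has its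
class lifted to this kernel, so the class is trivial. -/

/-- `M₀(G)` is a normal (indeed central) subgroup of `G ∧ G`. -/
theorem schurM₀_normal_exteriorSquare (G : Type*) [Group G] : (schurM₀ G).Normal where
  conj_mem n hn g := by
    rwa [Subgroup.mem_center_iff.mp (schurM_le_center (schurM₀_le_schurM hn)) g,
      mul_inv_cancel_right]

attribute [instance] schurM₀_normal_exteriorSquare

section CurlySquare

variable (G : Type*) [Group G]

/-- The quotient `(G ∧ G) / M₀(G)`. -/
abbrev CurlySquare : Type _ := ExteriorSquare G ⧸ schurM₀ G

variable {G}

/-- The class of `x ∧ y` in `(G ∧ G) / M₀(G)`. -/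
def curlyWedge (x y : G) : CurlySquare G := QuotientGroup.mk (wedge x y)

theorem curlyWedge_of_commute {x y : G} (h : Commute x y) : curlyWedge x y = 1 :=
  (QuotientGroup.eq_one_iff _).mpr (Subgroup.subset_closure ⟨x, y, h, rfl⟩)

theorem curlyWedge_mul_left (x y z : G) :
    curlyWedge (x * y) z = curlyWedge (rconj x y) (rconj z y) * curlyWedge y z :=
  congrArg QuotientGroup.mk (wedge_mul_left x y z)

theorem curlyWedge_mul_right (x y z : G) :
    curlyWedge x (y * z) = curlyWedge x z * curlyWedge (rconj x z) (rconj y z) :=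
  congrArg QuotientGroup.mk (wedge_mul_right x y z)

theorem rconj_of_mem_center {n : G} (hn : n ∈ Subgroup.center G) (x : G) : rconj x n = x := by
  rw [rconj, mul_assoc, Subgroup.mem_center_iff.mp hn x, inv_mul_cancel_left]

/-- Conjugation by `n` is trivial, and `n ∧ y` lies in `M₀(G)` since `n` commutes with `y`. -/
theorem curlyWedge_mul_center_left {n : G} (hn : n ∈ Subgroup.center G) (x y : G) :
    curlyWedge (x * n) y = curlyWedge x y := by
  rw [curlyWedge_mul_left, rconj_of_mem_center hn, rconj_of_mem_center hn,
    curlyWedge_of_commute (x := n) (Subgroup.mem_center_iff.mp hn y).symm, mul_one]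

theorem curlyWedge_mul_center_right {n : G} (hn : n ∈ Subgroup.center G) (x y : G) :
    curlyWedge x (y * n) = curlyWedge x y := by
  rw [curlyWedge_mul_right, rconj_of_mem_center hn, rconj_of_mem_center hn,
    curlyWedge_of_commute (y := n) (Subgroup.mem_center_iff.mp hn x), one_mul]

variable (G) in
/-- The homomorphism `(G ∧ G) / M₀(G) → G` induced by the commutator map. -/
def curlyCommutatorMap : CurlySquare G →* G :=
  QuotientGroup.lift (schurM₀ G) (commutatorMap G) schurM₀_le_schurM

theorem curlyCommutatorMap_curlyWedge (x y : G) :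
    curlyCommutatorMap G (curlyWedge x y) = x⁻¹ * y⁻¹ * x * y :=
  commutatorMap_wedge x y

end CurlySquare

section CentralExtension

variable {N G Q : Type*} [Group N] [Group G] [Group Q] {e : GroupExtension N G Q}

theorem IsCentral.exists_eq_mul_center (hc : IsCentral e) {g g' : G}
    (h : e.rightHom g = e.rightHom g') : ∃ n ∈ Subgroup.center G, g = g' * n := by
  refine ⟨g'⁻¹ * g, hc ?_, (mul_inv_cancel_left _ _).symm⟩
  rw [e.range_inl_eq_ker_rightHom, MonoidHom.mem_ker, map_mul, map_inv, h, inv_mul_cancel]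

/-- Two lifts of one element differ by a central factor, which the class ignores; this makes
`curlyLift` independent of the chosen section. -/
theorem IsCentral.curlyWedge_congr (hc : IsCentral e) {g g' h h' : G}
    (hg : e.rightHom g = e.rightHom g') (hh : e.rightHom h = e.rightHom h') :
    curlyWedge g h = curlyWedge g' h' := by
  obtain ⟨n, hn, rfl⟩ := hc.exists_eq_mul_center hg
  obtain ⟨m, hm, rfl⟩ := hc.exists_eq_mul_center hh
  rw [curlyWedge_mul_center_left hn, curlyWedge_mul_center_right hm]

theorem rightHom_rconj (g h : G) :
    e.rightHom (rconj g h) = rconj (e.rightHom g) (e.rightHom h) := by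
  simp [rconj]

/-- For a central extension `G` of `Q`, the homomorphism `Q ∧ Q → (G ∧ G) / M₀(G)` sending
`x ∧ y` to the class of `g ∧ h` for any lifts `g`, `h` of `x`, `y`. -/
noncomputable def curlyLift (hc : IsCentral e) : ExteriorSquare Q →* CurlySquare G :=
  PresentedGroup.toGroup (rels := exteriorRels Q)
    (f := fun p : Q × Q => curlyWedge (Function.surjInv e.rightHom_surjective p.1)
      (Function.surjInv e.rightHom_surjective p.2)) (by
    have hs := Function.surjInv_eq e.rightHom_surjective
    rintro r ((⟨x, y, z, rfl⟩ | ⟨x, y, z, rfl⟩) | ⟨x, rfl⟩)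
    · simp only [map_mul, map_inv, FreeGroup.lift_apply_of, mul_inv_eq_one]
      rw [← hc.curlyWedge_congr (g := Function.surjInv e.rightHom_surjective x *
          Function.surjInv e.rightHom_surjective y) (by simp only [map_mul, hs]) rfl,
        curlyWedge_mul_left]
      congr 1
      exact hc.curlyWedge_congr (by simp only [rightHom_rconj, hs])
        (by simp only [rightHom_rconj, hs])
    · simp only [map_mul, map_inv, FreeGroup.lift_apply_of, mul_inv_eq_one]
      rw [← hc.curlyWedge_congr (h := Function.surjInv e.rightHom_surjective y *
          Function.surjInv e.rightHom_surjective z) rfl (by simp only [map_mul, hs]),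
        curlyWedge_mul_right]
      congr 1
      exact hc.curlyWedge_congr (by simp only [rightHom_rconj, hs])
        (by simp only [rightHom_rconj, hs])
    · simpa only [FreeGroup.lift_apply_of] using curlyWedge_of_commute (Commute.refl _))

theorem curlyLift_wedge (hc : IsCentral e) (g h : G) :
    curlyLift hc (wedge (e.rightHom g) (e.rightHom h)) = curlyWedge g h := by
  have hs := Function.surjInv_eq e.rightHom_surjective
  exact (PresentedGroup.toGroup.of _).trans (hc.curlyWedge_congr (hs _) (hs _))

theorem curlyLift_surjective (hc : IsCentral e) : Function.Surjective (curlyLift hc) := by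
  intro t
  obtain ⟨t, rfl⟩ := QuotientGroup.mk_surjective t
  have ht : t ∈ Subgroup.closure
      (Set.range (PresentedGroup.of : G × G → PresentedGroup (exteriorRels G))) := by
    rw [PresentedGroup.closure_range_of]; trivial
  have hle : Subgroup.closure
      (Set.range (PresentedGroup.of : G × G → PresentedGroup (exteriorRels G))) ≤
      (curlyLift hc).range.comap (QuotientGroup.mk' (schurM₀ G)) := by
    rw [Subgroup.closure_le]
    rintro _ ⟨⟨a, b⟩, rfl⟩
    exact ⟨_, curlyLift_wedge hc a b⟩
  exact hle ht

/-- Since any lifts may be used to compute the image of `x ∧ y`, commuting ones can be chosen. -/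
theorem schurM₀_le_ker_curlyLift (hc : IsCentral e) (hcp : IsCP e) :
    schurM₀ Q ≤ (curlyLift hc).ker := by
  rw [schurM₀, Subgroup.closure_le]
  rintro _ ⟨x, y, hxy, rfl⟩
  obtain ⟨g, h, rfl, rfl, hgh⟩ := hcp x y hxy
  exact (curlyLift_wedge hc g h).trans (curlyWedge_of_commute hgh)

/-- For a central extension `G` of `Q`, the homomorphism `Q ∧ Q → G` sending `x ∧ y` to `[g, h]`
for any lifts `g`, `h` of `x`, `y`. -/
noncomputable def commutatorLift (hc : IsCentral e) : ExteriorSquare Q →* G :=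
  (curlyCommutatorMap G).comp (curlyLift hc)

theorem commutatorLift_wedge (hc : IsCentral e) (g h : G) :
    commutatorLift hc (wedge (e.rightHom g) (e.rightHom h)) = g⁻¹ * h⁻¹ * g * h := by
  rw [commutatorLift, MonoidHom.comp_apply, curlyLift_wedge, curlyCommutatorMap_curlyWedge]

theorem rightHom_commutatorLift (hc : IsCentral e) (t : ExteriorSquare Q) :
    e.rightHom (commutatorLift hc t) = commutatorMap Q t := by
  suffices h : e.rightHom.comp (commutatorLift hc) = commutatorMap Q from DFunLike.congr_fun h t
  apply PresentedGroup.ext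
  rintro ⟨x, y⟩
  obtain ⟨g, rfl⟩ := e.rightHom_surjective x
  obtain ⟨h, rfl⟩ := e.rightHom_surjective y
  change e.rightHom (commutatorLift hc (wedge (e.rightHom g) (e.rightHom h))) =
    commutatorMap Q (wedge (e.rightHom g) (e.rightHom h))
  rw [commutatorLift_wedge, commutatorMap_wedge]
  simp only [map_mul, map_inv]

theorem commutator_le_range_commutatorLift (hc : IsCentral e) :
    commutator G ≤ (commutatorLift hc).range := by
  rw [commutator_def, Subgroup.commutator_le]
  intro a _ b _
  -- Mathlib's `⁅a, b⁆` is `a * b * a⁻¹ * b⁻¹`, hence the inverses.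
  refine ⟨_, (commutatorLift_wedge hc a⁻¹ b⁻¹).trans ?_⟩
  simp [commutatorElement_def]

/-- In a central extension of a finite group the derived subgroup is finite. -/
theorem IsCentral.finite_commutator [Finite Q] (hc : IsCentral e) : Finite (commutator G) := by
  have : Finite (commutatorSet G) := by
    refine Set.Finite.subset
      (Set.finite_range fun p : Q × Q => commutatorLift hc (wedge p.1 p.2)) ?_
    rintro _ ⟨a, b, rfl⟩
    refine ⟨(e.rightHom a⁻¹, e.rightHom b⁻¹), (commutatorLift_wedge hc a⁻¹ b⁻¹).trans ?_⟩
    simp [commutatorElement_def]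
  -- Schur: a group with finitely many commutators has a finite derived subgroup.
  infer_instance

/-- For a central CP extension, the homomorphism `B₀(Q) → G` induced by `commutatorLift`. -/
noncomputable def bogomolovLift (hc : IsCentral e) (hcp : IsCP e) :
    BogomolovMultiplier Q →* G :=
  QuotientGroup.lift _ ((commutatorLift hc).comp (schurM Q).subtype) fun t ht => by
    have h : curlyLift hc t = 1 := schurM₀_le_ker_curlyLift hc hcp ht
    change curlyCommutatorMap G (curlyLift hc t) = 1
    rw [h, map_one]

/-- The stem condition gives surjectivity onto `N`: each element of `N` is the image of some `t` in
`Q ∧ Q`, and being trivial in `Q` it forces `t` into `M(Q)`. -/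
theorem range_bogomolovLift (hc : IsCentral e) (hs : IsStem e) (hcp : IsCP e) :
    (bogomolovLift hc hcp).range = e.inl.range := by
  apply le_antisymm
  · rintro _ ⟨t, rfl⟩
    obtain ⟨t, rfl⟩ := QuotientGroup.mk_surjective t
    rw [e.range_inl_eq_ker_rightHom]
    exact (rightHom_commutatorLift hc t).trans t.2
  · intro g hg
    obtain ⟨t, rfl⟩ := commutator_le_range_commutatorLift hc (hs hg)
    rw [e.range_inl_eq_ker_rightHom] at hg
    exact ⟨QuotientGroup.mk ⟨t, (rightHom_commutatorLift hc t).symm.trans hg⟩, rfl⟩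

/-- A surjection between finite sets of equal size is injective. Finiteness of `N` comes from its
embedding in the finite group `[G, G]`. -/
theorem IsCPCover.bogomolovLift_injective [Finite Q] (he : IsCPCover e) :
    Function.Injective (bogomolovLift he.central he.cp) := by
  have := he.central.finite_commutator
  have hfin : Finite e.inl.range :=
    Finite.of_injective _ (Subgroup.inclusion_injective he.stem)
  have hN : Finite N := Finite.of_injective _ (e.inl.ofInjective e.inl_injective).injective
  obtain ⟨f⟩ := he.card_eq
  have hB : Finite (BogomolovMultiplier Q) := Finite.of_equiv N f
  have hcard : Nat.card (BogomolovMultiplier Q) ≤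
      Nat.card (bogomolovLift he.central he.cp).range := by
    rw [range_bogomolovLift he.central he.stem he.cp, ← Nat.card_congr f,
      Nat.card_congr (e.inl.ofInjective e.inl_injective).toEquiv]
  have hbij := (bogomolovLift he.central he.cp).rangeRestrict_surjective.bijective_of_nat_card_le
    hcard
  exact (MonoidHom.rangeRestrict_injective_iff).mp hbij.injective

theorem IsCPCover.ker_commutatorLift_le [Finite Q] (he : IsCPCover e) :
    (commutatorLift he.central).ker ≤ schurM₀ Q := by
  intro t ht
  have ht1 : commutatorLift he.central t = 1 := ht
  have hM : t ∈ schurM Q := by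
    change commutatorMap Q t = 1
    rw [← rightHom_commutatorLift he.central, ht1, map_one]
  have h : (QuotientGroup.mk ⟨t, hM⟩ : BogomolovMultiplier Q) = 1 :=
    he.bogomolovLift_injective (ht1.trans (map_one _).symm)
  exact (QuotientGroup.eq_one_iff (⟨t, hM⟩ : schurM Q)).mp h

theorem IsCPCover.schurM_le_schurM₀ [Finite Q] (he : IsCPCover e) : schurM G ≤ schurM₀ G := by
  intro t ht
  obtain ⟨q, hq⟩ := curlyLift_surjective he.central (QuotientGroup.mk t)
  have hq1 : commutatorLift he.central q = 1 := by
    rw [commutatorLift, MonoidHom.comp_apply, hq]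
    -- On the class of `t`, `curlyCommutatorMap` is by definition `commutatorMap G t`.
    exact ht
  have h : curlyLift he.central q = 1 :=
    schurM₀_le_ker_curlyLift he.central he.cp (he.ker_commutatorLift_le hq1)
  exact (QuotientGroup.eq_one_iff t).mp (hq.symm.trans h)

end CentralExtension

end CPExt

theorem theorem4p4 {N G Q : Type*} [Group N] [Group G] [Group Q] [Finite Q]
    (e : GroupExtension N G Q) (he : CPExt.IsCPCover e) :
    Subsingleton (CPExt.BogomolovMultiplier G) := by
  rw [QuotientGroup.subsingleton_iff, Subgroup.subgroupOf_eq_top]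
  exact he.schurM_le_schurM₀
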